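/- Let $d\ge 1$ and let $\mathcal L g(x)=\frac1{2d}\sum_{i=1}^d\big(g(x+\boldsymbol e_i)+g(x-\boldsymbol e_i)\big)$, $x\in\mathbb Z^d$, be the transition operator of the simple random walk on $\mathbb Z^d$. For $n\ge1$ and a function $f$ on $\mathbb R^d$ put $P_nf(x)=f(x/\sqrt n)$, $x\in\mathbb Z^d$. Let $\mathfrak A=\frac1{2d}\sum_{i=1}^d\frac{\partial^2}{\partial x_i^2}$ be the Laplacian on $\mathbb R^d$ normalized by the factor $\frac1{2d}$, and let $(e^{t\mathfrak A})_{t\ge0}$ be its heat semigroup: $e^{0\mathfrak A}f=f$ and, for $t>0$ and $s=t/(2d)$, $$e^{t\mathfrak A}f(x)=\int_{\mathbb R^d}(4\pi s)^{-d/2}e^{-|x-y|^2/(4s)}f(y)\,dy .$$ Let $\|\cdot\|_\infty$ denote the supremum norm (on $\mathbb Z^d$ or on $\mathbb R^d$) and $[a]$ the integer part of $a$. Then for every real-valued $f\in C_c^\infty(\mathbb R^d)$, every $t\ge0$ and every $\lambda>0$ there is a constant $C=C(t,f,d,\lambda)>0$ such that for all integers $n\ge1$ $$ \begin{aligned} \|\mathcal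 L^{[nt]}P_nf-P_ne^{t\mathfrak A}f\|_\infty &\le\Big(\sqrt{\tfrac tn}+\tfrac1n\Big)\Big(\|\mathfrak Af\|_\infty+\frac d{6\sqrt n}\max_{1\le i\le d}\Big\|\frac{\partial^3f}{\partial x_i^3}\Big\|_\infty\Big)\\ &\quad+\frac d{3\lambda\sqrt n}\max_{1\le i\le d}\Big\|\frac{\partial^3f}{\partial x_i^3}\Big\|_\infty +\frac{dt}{6\lambda\sqrt n}\max_{1\le i\le d}\Big\|\frac{\partial^3(\lambda-\mathfrak A)f}{\partial x_i^3}\Big\|_\infty \le\frac C{\sqrt n}. \end{aligned} $$ -/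

import Mathlib

open scoped ContDiff

noncomputable section

/-- The supremum norm of a bounded real function (a real number). -/
def supNorm {X : Type*} (g : X → ℝ) : ℝ := ⨆ x, |g x|

/-- The transition operator of the simple random walk on `ℤ^d`:
`(1 / 2d) ∑ g (x + e)`, the sum being over the `2d` vectors `e = ± e_i`. -/
def transitionOp {d : ℕ} (g : (Fin d → ℤ) → ℝ) : (Fin d → ℤ) → ℝ :=
  fun x => 1 / (2 * (d : ℝ)) * ∑ i : Fin d, (g (x + Pi.single i 1) + g (x - Pi.single i 1))

/-- The scaling operator `P_n f (x) = f (x / √n)`, `x ∈ ℤ^d`. -/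
def scaleOp {d : ℕ} (n : ℕ) (f : EuclideanSpace ℝ (Fin d) → ℝ) : (Fin d → ℤ) → ℝ :=
  fun x => f (WithLp.toLp 2 fun i => (x i : ℝ) / √(n : ℝ))

/-- The heat semigroup `e^{sΔ}`, `s ≥ 0`, on `ℝ^d`, where `Δ = ∑ ∂²/∂x_i²`: convolution with the
heat kernel `(4πs)^{-d/2} exp (-|x|² / 4s)` for `s > 0`, and the identity for `s = 0`. -/
def heatSemigroup {d : ℕ} (s : ℝ) (f : EuclideanSpace ℝ (Fin d) → ℝ) :
    EuclideanSpace ℝ (Fin d) → ℝ :=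
  fun x => if s = 0 then f x else
    ∫ y, (4 * Real.pi * s) ^ (-(d : ℝ) / 2) * Real.exp (-‖x - y‖ ^ 2 / (4 * s)) * f y

/-- The generator `𝔄 = (1 / 2d) Δ` of the limiting semigroup. -/
def walkGenerator {d : ℕ} (f : EuclideanSpace ℝ (Fin d) → ℝ) : EuclideanSpace ℝ (Fin d) → ℝ :=
  fun x => 1 / (2 * (d : ℝ)) * Laplacian.laplacian f x

/-- The semigroup `e^{t𝔄} = e^{(t / 2d) Δ}`. -/
def walkSemigroup {d : ℕ} (t : ℝ) (f : EuclideanSpace ℝ (Fin d) → ℝ) :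
    EuclideanSpace ℝ (Fin d) → ℝ :=
  heatSemigroup (t / (2 * (d : ℝ))) f

/-- The third partial derivative `∂³f/∂x_i³`. -/
def thirdPartial {d : ℕ} (i : Fin d) (f : EuclideanSpace ℝ (Fin d) → ℝ) :
    EuclideanSpace ℝ (Fin d) → ℝ :=
  fun x => iteratedDeriv 3 (fun s : ℝ => f (x + s • EuclideanSpace.single i (1 : ℝ))) 0

/-- `max_i ‖∂³f/∂x_i³‖_∞`. -/
def maxThirdPartial {d : ℕ} (f : EuclideanSpace ℝ (Fin d) → ℝ) : ℝ :=
  ⨆ i : Fin d, supNorm (thirdPartial i f)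

/-- The explicit bound for the error in the semigroup central limit theorem. -/
def errorBound {d : ℕ} (l t : ℝ) (f : EuclideanSpace ℝ (Fin d) → ℝ) (n : ℕ) : ℝ :=
  (√(t / (n : ℝ)) + 1 / (n : ℝ)) *
      (supNorm (walkGenerator f) + (d : ℝ) / (6 * √(n : ℝ)) * maxThirdPartial f)
    + (d : ℝ) / (3 * l * √(n : ℝ)) * maxThirdPartial f
    + (d : ℝ) * t / (6 * l * √(n : ℝ)) * maxThirdPartial (fun x => l * f x - walkGenerator f x)

end

/-! ### Moments of the Poisson distribution. -/

section Poisson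

/-! Write `L` for the walk operator, a sup-norm contraction, and compare `L ^ m`, `m = [nt]`, with
the continuous-time walk `exp (r (L - 1))`, then that walk with the heat flow. Since `exp (m (L -
1))` averages the powers `L ^ k` over a Poisson law of mean `m`, and `L ^ k g - L ^ m g` costs at
most `|k - m|` steps of size `‖L g - g‖`, the standard deviation `√m` gives Chernoff's bound
`norm_exp_sub_pow_le`. Replacing `m` by `nt` costs at most one more step. The curve `w s = P_n
e^{s𝔄} f` nearly solves `w' = n (L - 1) w`. The heat semigroup commutes with translations, so the
defect is `e^{s𝔄}` applied to the Taylor error of the difference quotient of `f`. It is therefore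
`O(1/√n)` uniformly in `s`, and Duhamel (`norm_exp_apply_sub_le`) turns it into an error linear in
`t`. That `w` is differentiable in sup norm is read off on the Fourier side
(`exists_abs_heatSemigroup_sub_le`). This yields `abs_iterate_transitionOp_sub_walkSemigroup_le`, a
bound without `λ`. The parameter enters only through the maximum principle for `λ - 𝔄`, which bounds
`λ` times the third derivatives of `f` by those of `(λ - 𝔄) f`. -/

theorem hasSum_poisson_weight (r : ℝ) :
    HasSum (fun k : ℕ => Real.exp (-r) * (r ^ k / k.factorial)) 1 := by
  have h := (NormedSpace.expSeries_div_hasSum_exp r).mul_left (Real.exp (-r))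
  rwa [← Real.exp_eq_exp_ℝ, ← Real.exp_add, neg_add_cancel, Real.exp_zero] at h

theorem hasSum_poisson_mean (r : ℝ) :
    HasSum (fun k : ℕ => Real.exp (-r) * (r ^ k / k.factorial) * k) r := by
  rw [← hasSum_nat_add_iff' 1]
  have h := (hasSum_poisson_weight r).mul_left r
  simp only [Finset.range_one, Finset.sum_singleton, Nat.cast_zero, mul_zero, sub_zero]
  rw [mul_one] at h
  refine h.congr_fun fun k => ?_
  have : (k.factorial : ℝ) ≠ 0 := by positivity
  rw [Nat.factorial_succ]
  push_cast
  field_simp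
  ring

theorem hasSum_poisson_factorial_moment (r : ℝ) :
    HasSum (fun k : ℕ => Real.exp (-r) * (r ^ k / k.factorial) * (k * (k - 1))) (r ^ 2) := by
  rw [← hasSum_nat_add_iff' 1]
  have h := (hasSum_poisson_mean r).mul_left r
  simp only [Finset.range_one, Finset.sum_singleton, Nat.cast_zero, mul_zero, zero_mul, sub_zero]
  rw [← sq] at h
  refine h.congr_fun fun k => ?_
  have : (k.factorial : ℝ) ≠ 0 := by positivity
  rw [Nat.factorial_succ]
  push_cast
  field_simp
  ring

theorem hasSum_poisson_variance (r : ℝ) :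
    HasSum (fun k : ℕ => Real.exp (-r) * (r ^ k / k.factorial) * ((k : ℝ) - r) ^ 2) r := by
  have h := ((hasSum_poisson_factorial_moment r).add
    ((hasSum_poisson_mean r).mul_left (1 - 2 * r))).add ((hasSum_poisson_weight r).mul_left (r ^ 2))
  convert h using 1
  · ext k; ring
  · ring

/-- A bound for the first absolute central moment of the Poisson distribution. -/
theorem summable_poisson_abs_and_tsum_le {r : ℝ} (hr : 0 < r) :
    Summable (fun k : ℕ => Real.exp (-r) * (r ^ k / k.factorial) * |(k : ℝ) - r|) ∧
    ∑' k : ℕ, Real.exp (-r) * (r ^ k / k.factorial) * |(k : ℝ) - r| ≤ √r := by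
  have hs : 0 < √r := Real.sqrt_pos.2 hr
  -- AM-GM in place of Cauchy–Schwarz: `|a| ≤ (√r + a² / √r) / 2`, whose Poisson mean is exactly
  -- `√r` because the variance is `r`.
  have hb : HasSum (fun k : ℕ => Real.exp (-r) * (r ^ k / k.factorial) *
      ((√r + ((k : ℝ) - r) ^ 2 / √r) / 2)) (√r) := by
    have h := ((hasSum_poisson_weight r).mul_left (√r / 2)).add
      ((hasSum_poisson_variance r).mul_left (1 / (2 * √r)))
    have h2 : √r / 2 * 1 + 1 / (2 * √r) * r = √r := by
      nth_rewrite 3 [← Real.mul_self_sqrt hr.le]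
      field_simp; norm_num
    rw [h2] at h
    exact h.congr_fun fun k => by ring
  have hle : ∀ k : ℕ, Real.exp (-r) * (r ^ k / k.factorial) * |(k : ℝ) - r| ≤
      Real.exp (-r) * (r ^ k / k.factorial) * ((√r + ((k : ℝ) - r) ^ 2 / √r) / 2) := fun k => by
    refine mul_le_mul_of_nonneg_left ?_ (by positivity)
    rw [← sq_abs]
    have h : 0 ≤ (√r - |(k : ℝ) - r|) ^ 2 / √r := by positivity
    have : (√r - |(k : ℝ) - r|) ^ 2 / √r = √r + |(k : ℝ) - r| ^ 2 / √r - 2 * |(k : ℝ) - r| := by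
      field_simp; ring
    linarith
  have hsum := Summable.of_nonneg_of_le (fun k => by positivity) hle hb.summable
  exact ⟨hsum, hb.tsum_eq ▸ hsum.tsum_le_tsum hle hb.summable⟩

end Poisson

/-! ### Chernoff and Duhamel estimates for contractions. -/

section Contraction

open NormedSpace

variable {B : Type*} [NormedAddCommGroup B] [NormedSpace ℝ B]

theorem norm_pow_apply_le_of_norm_le_one {L : B →L[ℝ] B} (hL : ‖L‖ ≤ 1) (k : ℕ) (g : B) :
    ‖(L ^ k) g‖ ≤ ‖g‖ := by
  induction k with
  | zero => simp
  | succ k ih =>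
    rw [pow_succ', mul_apply_eq_comp]
    exact (L.le_of_opNorm_le hL _).trans (by simpa using ih)

/-- Telescoping: each extra power adds a term `L ^ i (L g - g)`, which the contraction does not
enlarge. -/
theorem norm_pow_add_sub_pow_le {L : B →L[ℝ] B} (hL : ‖L‖ ≤ 1) (j k : ℕ) (g : B) :
    ‖(L ^ (j + k)) g - (L ^ j) g‖ ≤ k * ‖L g - g‖ := by
  induction k with
  | zero => simp
  | succ k ih =>
    have h : (L ^ (j + (k + 1))) g - (L ^ j) g =
        (L ^ (j + k)) (L g - g) + ((L ^ (j + k)) g - (L ^ j) g) := by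
      rw [← add_assoc, pow_succ, mul_apply_eq_comp, map_sub]; abel
    rw [h]
    refine (norm_add_le _ _).trans ?_
    have := norm_pow_apply_le_of_norm_le_one hL (j + k) (L g - g)
    rw [Nat.cast_succ]; linarith

theorem norm_pow_sub_pow_le {L : B →L[ℝ] B} (hL : ‖L‖ ≤ 1) (j k : ℕ) (g : B) :
    ‖(L ^ k) g - (L ^ j) g‖ ≤ |(k : ℝ) - j| * ‖L g - g‖ := by
  rcases le_total j k with h | h
  · obtain ⟨i, rfl⟩ := Nat.exists_eq_add_of_le h
    simpa using norm_pow_add_sub_pow_le hL j i g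
  · obtain ⟨i, rfl⟩ := Nat.exists_eq_add_of_le h
    rw [norm_sub_rev]
    simpa using norm_pow_add_sub_pow_le hL k i g

variable [CompleteSpace B]

theorem exp_smul_sub_one (L : B →L[ℝ] B) (r : ℝ) :
    exp (r • (L - 1)) = Real.exp (-r) • exp (r • L) := by
  have h : r • (L - 1) = r • L + algebraMap ℝ (B →L[ℝ] B) (-r) := by
    rw [Algebra.algebraMap_eq_smul_one]; module
  have hc : Commute (r • L) (algebraMap ℝ (B →L[ℝ] B) (-r)) :=
    (Algebra.commute_algebraMap_left _ _).symm
  let : NormedAlgebra ℚ (B →L[ℝ] B) := .restrictScalars ℚ ℝ _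
  rw [h, exp_add_of_commute hc, ← algebraMap_exp_comm, ← Real.exp_eq_exp_ℝ,
    Algebra.algebraMap_eq_smul_one, mul_smul_comm, mul_one]

/-- The semigroup generated by `L - 1` is a Poisson average of the powers of `L`. -/
theorem hasSum_exp_smul_sub_one_apply (L : B →L[ℝ] B) (r : ℝ) (g : B) :
    HasSum (fun k : ℕ => (Real.exp (-r) * (r ^ k / k.factorial)) • (L ^ k) g)
      (exp (r • (L - 1)) g) := by
  have h := exp_series_hasSum_exp' (𝕂 := ℝ) (r • L)
  have h2 := (h.mapL (ContinuousLinearMap.apply ℝ B g)).const_smul (Real.exp (-r))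
  rw [exp_smul_sub_one]
  refine h2.congr_fun fun k => ?_
  simp only [smul_pow, ContinuousLinearMap.apply_apply, smul_apply, smul_smul]
  congr 1; ring

theorem norm_exp_smul_sub_one_apply_le {L : B →L[ℝ] B} (hL : ‖L‖ ≤ 1) {r : ℝ} (hr : 0 ≤ r)
    (g : B) : ‖exp (r • (L - 1)) g‖ ≤ ‖g‖ := by
  have h := hasSum_exp_smul_sub_one_apply L r g
  have hw := (hasSum_poisson_weight r).mul_right ‖g‖
  rw [one_mul] at hw
  rw [← h.tsum_eq]
  refine tsum_of_norm_bounded hw fun k => ?_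
  rw [norm_smul, Real.norm_of_nonneg (by positivity)]
  exact mul_le_mul_of_nonneg_left (norm_pow_apply_le_of_norm_le_one hL k g) (by positivity)

/-- Chernoff's estimate for powers of a contraction. -/
theorem norm_exp_sub_pow_le {L : B →L[ℝ] B} (hL : ‖L‖ ≤ 1) (m : ℕ) (g : B) :
    ‖exp ((m : ℝ) • (L - 1)) g - (L ^ m) g‖ ≤ √m * ‖L g - g‖ := by
  rcases Nat.eq_zero_or_pos m with rfl | hm
  · simp
  obtain ⟨hs, hle⟩ := summable_poisson_abs_and_tsum_le (r := m) (by exact_mod_cast hm)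
  have hp (k : ℕ) : 0 ≤ Real.exp (-m) * ((m : ℝ) ^ k / k.factorial) := by positivity
  -- The Poisson weights have total mass one, so `L ^ m g` is itself the average of a constant and
  -- the difference can be taken term by term.
  have h := (hasSum_exp_smul_sub_one_apply L m g).sub
    ((hasSum_poisson_weight (m : ℝ)).smul_const ((L ^ m) g))
  rw [one_smul] at h
  rw [← h.tsum_eq]
  refine (tsum_of_norm_bounded (hs.hasSum.mul_right ‖L g - g‖) fun k => ?_).trans
    (mul_le_mul_of_nonneg_right hle (norm_nonneg _))
  rw [← smul_sub, norm_smul, Real.norm_of_nonneg (hp k), mul_assoc (_ * _)]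
  exact mul_le_mul_of_nonneg_left (norm_pow_sub_pow_le hL m k g) (hp k)

/-- Duhamel's estimate: a curve which nearly solves `w' = c (L - 1) w` stays close to the
solution. -/
theorem norm_exp_apply_sub_le {L : B →L[ℝ] B} (hL : ‖L‖ ≤ 1) {c : ℝ} (hc : 0 ≤ c)
    {w w' : ℝ → B} {t ε : ℝ} (ht : 0 ≤ t)
    (hw : ∀ s, 0 ≤ s → HasDerivWithinAt w (w' s) (Set.Ici 0) s)
    (hε : ∀ s, 0 ≤ s → ‖w' s - c • (L (w s) - w s)‖ ≤ ε) :
    ‖exp ((t * c) • (L - 1)) (w 0) - w t‖ ≤ ε * t := by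
  set A : B →L[ℝ] B := c • (L - 1) with hA
  have hE : ∀ s, HasDerivAt (fun s : ℝ => exp ((t - s) • A)) (-(exp ((t - s) • A) * A)) s := by
    intro s
    have h := (hasDerivAt_exp_smul_const (𝕂 := ℝ) A (t - s)).scomp s
      ((hasDerivAt_id s).const_sub t)
    simpa using! h
  -- Interpolate by `s ↦ exp ((t - s) A) (w s)`, which runs from `exp (t A) (w 0)` to `w t`. Its
  -- derivative is the contraction `exp ((t - s) A)` applied to the defect of `w`.
  have hF : ∀ s, 0 ≤ s → HasDerivWithinAt (fun s => exp ((t - s) • A) (w s))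
      (exp ((t - s) • A) (w' s - A (w s))) (Set.Ici 0) s := by
    intro s hs
    have h := (hE s).hasDerivWithinAt.clm_apply (hw s hs)
    refine h.congr_deriv ?_
    simp only [neg_apply, mul_apply_eq_comp, map_sub]
    abel
  have h := norm_image_sub_le_of_norm_deriv_right_le_segment
    (f := fun s => exp ((t - s) • A) (w s)) (a := 0) (b := t) (C := ε)
    (fun s hs => (hF s hs.1).continuousWithinAt.mono Set.Icc_subset_Ici_self)
    (fun s hs => (hF s hs.1).mono (Set.Ici_subset_Ici.2 hs.1))
    (fun s hs => by
      have h1 := norm_exp_smul_sub_one_apply_le hL (r := (t - s) * c)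
        (mul_nonneg (sub_nonneg.2 hs.2.le) hc) (w' s - A (w s))
      rw [mul_smul] at h1
      refine h1.trans ?_
      have := hε s hs.1
      simpa [hA] using this)
    t ⟨ht, le_rfl⟩
  rw [norm_sub_rev]
  simpa [hA, smul_smul] using h

/-- The semigroup generated by `L - 1` is Lipschitz in time. -/
theorem norm_exp_apply_sub_exp_apply_le {L : B →L[ℝ] B} (hL : ‖L‖ ≤ 1) {r h : ℝ} (hr : 0 ≤ r)
    (hh : 0 ≤ h) (g : B) :
    ‖exp ((r + h) • (L - 1)) g - exp (r • (L - 1)) g‖ ≤ h * ‖L g - g‖ := by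
  let : NormedAlgebra ℚ (B →L[ℝ] B) := .restrictScalars ℚ ℝ _
  have h1 : exp ((r + h) • (L - 1)) g = exp (r • (L - 1)) (exp (h • (L - 1)) g) := by
    rw [add_smul, exp_add_of_commute, mul_apply_eq_comp]
    exact ((Commute.refl (L - 1)).smul_left r).smul_right h
  rw [h1, ← map_sub]
  refine (norm_exp_smul_sub_one_apply_le hL hr _).trans ?_
  -- The constant curve `g` solves the equation with constant defect `g - L g`.
  have h2 := norm_exp_apply_sub_le hL (c := 1) zero_le_one (w := fun _ => g) (w' := fun _ => 0)
    (ε := ‖L g - g‖) hh (fun s _ => hasDerivWithinAt_const _ _ _)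
    (fun s _ => by rw [zero_sub, norm_neg, one_smul])
  rw [mul_one] at h2
  linarith

/-- Chernoff's approximation of a near solution of `w' = c (L - 1) w` by powers of `L`. -/
theorem norm_pow_apply_sub_le {L : B →L[ℝ] B} (hL : ‖L‖ ≤ 1) {c : ℝ} (hc : 0 ≤ c)
    {w w' : ℝ → B} {t ε : ℝ} (ht : 0 ≤ t)
    (hw : ∀ s, 0 ≤ s → HasDerivWithinAt w (w' s) (Set.Ici 0) s)
    (hε : ∀ s, 0 ≤ s → ‖w' s - c • (L (w s) - w s)‖ ≤ ε) {m : ℕ} (hm : m ≤ t * c) :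
    ‖(L ^ m) (w 0) - w t‖ ≤ (√m + (t * c - m)) * ‖L (w 0) - w 0‖ + ε * t := by
  have h1 := norm_exp_sub_pow_le hL m (w 0)
  have h2 := norm_exp_apply_sub_exp_apply_le hL (Nat.cast_nonneg m) (sub_nonneg.2 hm) (w 0)
  have h3 := norm_exp_apply_sub_le hL hc ht hw hε
  rw [add_sub_cancel, norm_sub_rev] at h2
  rw [norm_sub_rev] at h1
  have h4 : (L ^ m) (w 0) - w t = (L ^ m) (w 0) - exp ((m : ℝ) • (L - 1)) (w 0) +
      (exp ((m : ℝ) • (L - 1)) (w 0) - exp ((t * c) • (L - 1)) (w 0)) +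
      (exp ((t * c) • (L - 1)) (w 0) - w t) := by abel
  rw [h4]
  refine norm_add₃_le.trans ?_
  rw [add_mul]
  linarith

end Contraction

/-! ### Calculus of iterated directional derivatives. -/

section DirectionalDerivative

variable {E : Type*} [NormedAddCommGroup E] [NormedSpace ℝ E]

/-- The derivative of `g` in the direction `v`, as an operator on functions. -/
noncomputable def dirDeriv (v : E) (g : E → ℝ) : E → ℝ := fun x => fderiv ℝ g x v

theorem ContDiff.dirDeriv {g : E → ℝ} (hg : ContDiff ℝ ∞ g) (v : E) :
    ContDiff ℝ ∞ (dirDeriv v g) :=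
  (hg.fderiv_right (m := ∞) le_rfl).clm_apply contDiff_const

theorem HasCompactSupport.dirDeriv {g : E → ℝ} (hg : HasCompactSupport g) (v : E) :
    HasCompactSupport (dirDeriv v g) :=
  hg.fderiv_apply ℝ v

theorem ContDiff.hasDerivAt_comp_add_smul {g : E → ℝ} (hg : ContDiff ℝ ∞ g) (x v : E) (s : ℝ) :
    HasDerivAt (fun s : ℝ => g (x + s • v)) (_root_.dirDeriv v g (x + s • v)) s := by
  have h1 : HasDerivAt (fun s : ℝ => x + s • v) v s := by
    simpa using ((hasDerivAt_id s).smul_const v).const_add x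
  exact ((hg.differentiable (by simp)) _).hasFDerivAt.comp_hasDerivAt s h1

theorem ContDiff.iterate_dirDeriv {g : E → ℝ} (hg : ContDiff ℝ ∞ g) (v : E) (k : ℕ) :
    ContDiff ℝ ∞ ((_root_.dirDeriv v)^[k] g) := by
  induction k with
  | zero => exact hg
  | succ k ih => rw [Function.iterate_succ_apply']; exact ih.dirDeriv v

theorem HasCompactSupport.iterate_dirDeriv {g : E → ℝ} (hg : HasCompactSupport g) (v : E) (k : ℕ) :
    HasCompactSupport ((_root_.dirDeriv v)^[k] g) := by
  induction k with
  | zero => exact hg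
  | succ k ih => rw [Function.iterate_succ_apply']; exact ih.dirDeriv v

theorem ContDiff.iteratedDeriv_comp_add_smul {g : E → ℝ} (hg : ContDiff ℝ ∞ g) (x v : E) (k : ℕ) :
    iteratedDeriv k (fun s : ℝ => g (x + s • v)) =
      fun s => (_root_.dirDeriv v)^[k] g (x + s • v) := by
  induction k with
  | zero => simp
  | succ k ih =>
    rw [iteratedDeriv_succ, ih, Function.iterate_succ_apply']
    ext s
    exact ((hg.iterate_dirDeriv v k).hasDerivAt_comp_add_smul x v s).deriv

theorem ContDiff.dirDeriv_dirDeriv_apply {g : E → ℝ} (hg : ContDiff ℝ ∞ g) (v w x : E) :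
    _root_.dirDeriv v (_root_.dirDeriv w g) x = fderiv ℝ (fderiv ℝ g) x v w := by
  have h : DifferentiableAt ℝ (fderiv ℝ g) x :=
    ((hg.fderiv_right (m := ∞) le_rfl).differentiable (by simp)) x
  have := (h.hasFDerivAt.clm_apply (hasFDerivAt_const w x)).fderiv
  unfold _root_.dirDeriv
  rw [this]
  simp

theorem ContDiff.dirDeriv_comm {g : E → ℝ} (hg : ContDiff ℝ ∞ g) (v w : E) :
    _root_.dirDeriv v (_root_.dirDeriv w g) = _root_.dirDeriv w (_root_.dirDeriv v g) := by
  ext x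
  rw [hg.dirDeriv_dirDeriv_apply, hg.dirDeriv_dirDeriv_apply]
  exact (hg.contDiffAt.isSymmSndFDerivAt (by simpa using ENat.LEInfty.out)) v w

theorem dirDeriv_const_mul {g : E → ℝ} (hg : ContDiff ℝ ∞ g) (v : E) (c : ℝ) :
    dirDeriv v (fun x => c * g x) = fun x => c * dirDeriv v g x := by
  ext x
  simp [dirDeriv, fderiv_const_mul (hg.differentiable (by simp) x)]

theorem dirDeriv_sub {g h : E → ℝ} (hg : ContDiff ℝ ∞ g) (hh : ContDiff ℝ ∞ h) (v : E) :
    dirDeriv v (fun x => g x - h x) = fun x => dirDeriv v g x - dirDeriv v h x := by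
  ext x
  simp [dirDeriv, fderiv_fun_sub (hg.differentiable (by simp) x) (hh.differentiable (by simp) x)]

theorem dirDeriv_sum {ι : Type*} {s : Finset ι} {g : ι → E → ℝ} (hg : ∀ i, ContDiff ℝ ∞ (g i))
    (v : E) : dirDeriv v (fun x => ∑ i ∈ s, g i x) = fun x => ∑ i ∈ s, dirDeriv v (g i) x := by
  ext x
  simp [dirDeriv, fderiv_fun_sum fun i _ => (hg i).differentiable (by simp) x]

end DirectionalDerivative

/-! ### One-variable Taylor estimates. -/

section Taylor

/-- Integrates a monomial bound once, raising its degree; iterated below to reach the Taylor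
remainder. -/
theorem abs_le_of_abs_hasDerivAt_le {f f' : ℝ → ℝ} (h0 : f 0 = 0)
    (hf : ∀ s, HasDerivAt f (f' s) s) {c : ℝ} {k : ℕ}
    (hb : ∀ s, 0 ≤ s → |f' s| ≤ c * (k + 1) * s ^ k) {s : ℝ} (hs : 0 ≤ s) :
    |f s| ≤ c * s ^ (k + 1) :=
  image_norm_le_of_norm_deriv_right_le_deriv_boundary (f := f) (a := 0) (b := s)
    (B := fun s => c * s ^ (k + 1)) (B' := fun s => c * (k + 1) * s ^ k)
    (fun x _ => (hf x).continuousAt.continuousWithinAt) (fun x _ => (hf x).hasDerivWithinAt)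
    (by simp [h0])
    (fun x => by simpa [mul_assoc] using (hasDerivAt_pow (k + 1) x).const_mul c)
    (fun x hx => hb x hx.1) ⟨hs, le_rfl⟩

/-- The error of the symmetric second difference quotient. -/
theorem abs_symmetric_second_difference_sub_le {f f₁ f₂ f₃ : ℝ → ℝ}
    (h1 : ∀ s, HasDerivAt f (f₁ s) s) (h2 : ∀ s, HasDerivAt f₁ (f₂ s) s)
    (h3 : ∀ s, HasDerivAt f₂ (f₃ s) s) {M : ℝ} (hM : ∀ s, |f₃ s| ≤ M) {h : ℝ} (hh : 0 ≤ h) :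
    |f h + f (-h) - 2 * f 0 - h ^ 2 * f₂ 0| ≤ M / 3 * h ^ 3 := by
  have hneg {u u' : ℝ → ℝ} (hu : ∀ s, HasDerivAt u (u' s) s) (s : ℝ) :
      HasDerivAt (fun s => u (-s)) (-u' (-s)) s := by
    simpa using! (hu (-s)).scomp s (hasDerivAt_neg s)
  -- Integrating up from the third derivative gives successively `2 M s`, `M s²` and `M s³ / 3`;
  -- symmetrization makes each function vanish at zero.
  have e3 : ∀ s, 0 ≤ s → |f₂ s + f₂ (-s) - 2 * f₂ 0| ≤ 2 * M * s ^ (0 + 1) := fun s hs => by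
    refine abs_le_of_abs_hasDerivAt_le (f := fun s => f₂ s + f₂ (-s) - 2 * f₂ 0)
      (f' := fun s => f₃ s - f₃ (-s)) (by simp; ring)
      (fun s => ?_) (fun s _ => ?_) hs
    · simpa [sub_eq_add_neg] using ((h3 s).add (hneg h3 s)).sub_const (2 * f₂ 0)
    · have := abs_sub (f₃ s) (f₃ (-s))
      have := hM s
      have := hM (-s)
      simp; linarith
  have e2 : ∀ s, 0 ≤ s → |f₁ s - f₁ (-s) - 2 * s * f₂ 0| ≤ M * s ^ (1 + 1) := fun s hs => by
    refine abs_le_of_abs_hasDerivAt_le (f := fun s => f₁ s - f₁ (-s) - 2 * s * f₂ 0)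
      (f' := fun s => f₂ s + f₂ (-s) - 2 * f₂ 0) (by simp)
      (fun s => ?_) (fun s hs => ?_) hs
    · have := ((h2 s).sub (hneg h2 s)).sub (((hasDerivAt_id s).const_mul 2).mul_const (f₂ 0))
      simpa using! this
    · refine (e3 s hs).trans (le_of_eq ?_)
      push_cast; ring
  refine abs_le_of_abs_hasDerivAt_le (f := fun h => f h + f (-h) - 2 * f 0 - h ^ 2 * f₂ 0)
      (f' := fun s => f₁ s - f₁ (-s) - 2 * s * f₂ 0) (by simp; ring)
      (fun s => ?_) (fun s hs => ?_) hh
  · have := (((h1 s).add (hneg h1 s)).sub_const (2 * f 0)).sub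
      ((hasDerivAt_pow 2 s).mul_const (f₂ 0))
    simpa [sub_eq_add_neg] using! this
  · refine (e2 s hs).trans (le_of_eq ?_)
    push_cast; ring

/-- The second derivative test at a global maximum. -/
theorem second_deriv_nonpos_of_forall_le {f f₁ f₂ : ℝ → ℝ}
    (h1 : ∀ s, HasDerivAt f (f₁ s) s) (h2 : ∀ s, HasDerivAt f₁ (f₂ s) s)
    (hmax : ∀ s, f s ≤ f 0) : f₂ 0 ≤ 0 := by
  by_contra! hpos
  have hd : deriv f = f₁ := funext fun s => (h1 s).deriv
  have hd2 : deriv f₁ = f₂ := funext fun s => (h2 s).deriv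
  have hlmax : IsLocalMax f 0 := Filter.Eventually.of_forall hmax
  have hz : deriv f 0 = 0 := hlmax.deriv_eq_zero
  -- A positive second derivative would also make the maximum a local minimum, hence `f` locally
  -- constant, forcing that derivative to vanish.
  have hlmin : IsLocalMin f 0 :=
    isLocalMin_of_deriv_deriv_pos (by rwa [hd, hd2]) hz (h1 0).continuousAt
  have hconst : f =ᶠ[nhds 0] fun _ => f 0 := by
    filter_upwards [hlmin] with s hs using le_antisymm (hmax s) hs
  have h3 := hconst.deriv.deriv_eq
  rw [hd, hd2] at h3
  simp at h3
  exact hpos.ne' h3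

end Taylor

/-! ### Basic properties of the supremum norm. -/

section SupNorm

theorem supNorm_nonneg {X : Type*} (g : X → ℝ) : 0 ≤ supNorm g :=
  Real.iSup_nonneg fun _ => abs_nonneg _

theorem bddAbove_abs_of_hasCompactSupport {X : Type*} [TopologicalSpace X] {g : X → ℝ}
    (hg : Continuous g) (hc : HasCompactSupport g) : BddAbove (Set.range fun x => |g x|) := by
  obtain ⟨C, hC⟩ := hg.bounded_above_of_compact_support hc
  exact ⟨C, by rintro _ ⟨x, rfl⟩; exact hC x⟩

/-- Boundedness is essential here: the real supremum of an unbounded family is `0` by convention. -/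
theorem abs_le_supNorm {X : Type*} [TopologicalSpace X] {g : X → ℝ}
    (hg : Continuous g) (hc : HasCompactSupport g) (x : X) : |g x| ≤ supNorm g :=
  le_ciSup (bddAbove_abs_of_hasCompactSupport hg hc) x

theorem supNorm_le {X : Type*} {g : X → ℝ} {c : ℝ} (hc : 0 ≤ c) (h : ∀ x, |g x| ≤ c) :
    supNorm g ≤ c :=
  Real.iSup_le h hc

end SupNorm

/-! ### The generator: maximum principle and discretization error. -/

section Generator

variable {d : ℕ}

theorem walkGenerator_eq_sum {g : EuclideanSpace ℝ (Fin d) → ℝ} (hg : ContDiff ℝ ∞ g) :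
    walkGenerator g = fun x => 1 / (2 * (d : ℝ)) * ∑ j : Fin d,
      dirDeriv (EuclideanSpace.single j (1 : ℝ)) (dirDeriv (EuclideanSpace.single j 1) g) x := by
  ext x
  rw [walkGenerator, InnerProductSpace.laplacian_eq_iteratedFDeriv_orthonormalBasis g
    (EuclideanSpace.basisFun (Fin d) ℝ)]
  simp [iteratedFDeriv_two_apply, hg.dirDeriv_dirDeriv_apply]

theorem ContDiff.walkGenerator {g : EuclideanSpace ℝ (Fin d) → ℝ} (hg : ContDiff ℝ ∞ g) :
    ContDiff ℝ ∞ (walkGenerator g) := by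
  rw [walkGenerator_eq_sum hg]
  exact contDiff_const.mul (ContDiff.sum fun j _ => (hg.dirDeriv _).dirDeriv _)

theorem HasCompactSupport.walkGenerator {g : EuclideanSpace ℝ (Fin d) → ℝ} (hg : ContDiff ℝ ∞ g)
    (hc : HasCompactSupport g) : HasCompactSupport (walkGenerator g) := by
  rw [walkGenerator_eq_sum hg]
  refine HasCompactSupport.intro hc.isCompact fun x hx => ?_
  rw [Finset.sum_eq_zero, mul_zero]
  intro j _
  exact image_eq_zero_of_notMem_tsupport fun h => hx
    ((tsupport_fderiv_apply_subset ℝ _).trans (tsupport_fderiv_apply_subset ℝ _) h)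

theorem dirDeriv_walkGenerator {g : EuclideanSpace ℝ (Fin d) → ℝ} (hg : ContDiff ℝ ∞ g)
    (v : EuclideanSpace ℝ (Fin d)) :
    dirDeriv v (walkGenerator g) = walkGenerator (dirDeriv v g) := by
  rw [walkGenerator_eq_sum hg, walkGenerator_eq_sum (hg.dirDeriv v),
    dirDeriv_const_mul (ContDiff.sum fun j _ => (hg.dirDeriv _).dirDeriv _),
    dirDeriv_sum fun j => (hg.dirDeriv _).dirDeriv _]
  ext x
  simp only [(hg.dirDeriv _).dirDeriv_comm v, hg.dirDeriv_comm v]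

/-- Constant-coefficient operators commute; this lets the maximum principle act on the third
derivatives of `g`. -/
theorem iterate_dirDeriv_resolvent {g : EuclideanSpace ℝ (Fin d) → ℝ} (hg : ContDiff ℝ ∞ g)
    (v : EuclideanSpace ℝ (Fin d)) (l : ℝ) (k : ℕ) :
    (dirDeriv v)^[k] (fun x => l * g x - walkGenerator g x) =
      fun x => l * (dirDeriv v)^[k] g x - walkGenerator ((dirDeriv v)^[k] g) x := by
  induction k with
  | zero => rfl
  | succ k ih =>
    have hk := hg.iterate_dirDeriv v k
    simp only [Function.iterate_succ_apply'] at ih ⊢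
    rw [ih, dirDeriv_sub (contDiff_const.mul hk) hk.walkGenerator, dirDeriv_const_mul hk,
      dirDeriv_walkGenerator hk]

theorem walkGenerator_nonpos_of_forall_le {g : EuclideanSpace ℝ (Fin d) → ℝ} (hg : ContDiff ℝ ∞ g)
    {x : EuclideanSpace ℝ (Fin d)} (hx : ∀ y, g y ≤ g x) : walkGenerator g x ≤ 0 := by
  rw [walkGenerator_eq_sum hg]
  refine mul_nonpos_of_nonneg_of_nonpos (by positivity) (Finset.sum_nonpos fun j _ => ?_)
  have := second_deriv_nonpos_of_forall_le (hg.hasDerivAt_comp_add_smul x _)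
    ((hg.dirDeriv (EuclideanSpace.single j (1 : ℝ))).hasDerivAt_comp_add_smul x _)
    (fun s => by simpa using hx _)
  simpa using this

/-- The maximum principle for the resolvent equation. -/
theorem mul_le_supNorm_resolvent {g : EuclideanSpace ℝ (Fin d) → ℝ} (hg : ContDiff ℝ ∞ g)
    (hc : HasCompactSupport g) {l : ℝ} (hl : 0 < l) (x : EuclideanSpace ℝ (Fin d)) :
    l * g x ≤ supNorm fun x => l * g x - walkGenerator g x := by
  -- At a global maximum `y` the generator is nonpositive, so `l * g y` is at most the resolvent
  -- expression there.
  obtain ⟨y, hy⟩ := hg.continuous.exists_forall_ge_of_hasCompactSupport hc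
  have h1 := walkGenerator_nonpos_of_forall_le hg hy
  have h2 := abs_le_supNorm (g := fun x => l * g x - walkGenerator g x)
    ((contDiff_const.mul hg).sub hg.walkGenerator).continuous
    ((hc.mul_left (f := fun _ => l)).sub (hc.walkGenerator hg)) y
  have h3 := mul_le_mul_of_nonneg_left (hy x) hl.le
  have h4 := le_abs_self (l * g y - walkGenerator g y)
  linarith

theorem walkGenerator_neg (g : EuclideanSpace ℝ (Fin d) → ℝ) :
    walkGenerator (-g) = -walkGenerator g := by
  ext x
  simp [walkGenerator, InnerProductSpace.laplacian_neg]

theorem mul_supNorm_le_supNorm_resolvent {g : EuclideanSpace ℝ (Fin d) → ℝ} (hg : ContDiff ℝ ∞ g)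
    (hc : HasCompactSupport g) {l : ℝ} (hl : 0 < l) :
    l * supNorm g ≤ supNorm fun x => l * g x - walkGenerator g x := by
  rw [← le_div_iff₀' hl]
  refine supNorm_le (div_nonneg (supNorm_nonneg _) hl.le) fun x => ?_
  rw [le_div_iff₀' hl]
  have h1 := mul_le_supNorm_resolvent hg hc hl x
  have h2 := mul_le_supNorm_resolvent hg.neg hc.neg hl x
  have h3 : supNorm (fun x => l * (-g) x - walkGenerator (-g) x) =
      supNorm fun x => l * g x - walkGenerator g x := by
    simp only [supNorm, walkGenerator_neg, Pi.neg_apply]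
    congr 1; ext x
    rw [← abs_neg]; congr 1; ring
  rw [← h3] at h1 ⊢
  rcases abs_cases (g x) with ⟨h, -⟩ | ⟨h, -⟩
  · rwa [h]
  · rw [h]; exact h2

theorem thirdPartial_eq {g : EuclideanSpace ℝ (Fin d) → ℝ} (hg : ContDiff ℝ ∞ g) (i : Fin d) :
    thirdPartial i g = (dirDeriv (EuclideanSpace.single i (1 : ℝ)))^[3] g := by
  ext x
  rw [thirdPartial, hg.iteratedDeriv_comp_add_smul]
  simp

theorem supNorm_thirdPartial_le_max (g : EuclideanSpace ℝ (Fin d) → ℝ) (i : Fin d) :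
    supNorm (thirdPartial i g) ≤ maxThirdPartial g :=
  le_ciSup (f := fun i => supNorm (thirdPartial i g)) (Set.finite_range _).bddAbove i

theorem maxThirdPartial_nonneg (g : EuclideanSpace ℝ (Fin d) → ℝ) : 0 ≤ maxThirdPartial g :=
  Real.iSup_nonneg fun _ => supNorm_nonneg _

/-- The sole source of the `λ`-dependent term: the resolvent maximum principle applied to each third
partial derivative. -/
theorem mul_maxThirdPartial_le_resolvent {g : EuclideanSpace ℝ (Fin d) → ℝ} (hg : ContDiff ℝ ∞ g)
    (hc : HasCompactSupport g) {l : ℝ} (hl : 0 < l) :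
    l * maxThirdPartial g ≤ maxThirdPartial fun x => l * g x - walkGenerator g x := by
  rw [← le_div_iff₀' hl]
  refine Real.iSup_le (fun i => ?_) (div_nonneg (maxThirdPartial_nonneg _) hl.le)
  rw [le_div_iff₀' hl]
  refine le_trans ?_ (supNorm_thirdPartial_le_max _ i)
  rw [thirdPartial_eq hg, thirdPartial_eq ((contDiff_const.mul hg).sub hg.walkGenerator),
    iterate_dirDeriv_resolvent hg]
  exact mul_supNorm_le_supNorm_resolvent (hg.iterate_dirDeriv _ 3) (hc.iterate_dirDeriv _ 3) hl

/-- The error of the rescaled generator of the random walk on smooth functions. -/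
theorem abs_discrete_generator_sub_le (hd : 1 ≤ d) {g : EuclideanSpace ℝ (Fin d) → ℝ}
    (hg : ContDiff ℝ ∞ g)
    (hc : HasCompactSupport g) {h : ℝ} (hh : 0 < h) (x : EuclideanSpace ℝ (Fin d)) :
    |(1 / (2 * (d : ℝ)) * ∑ i : Fin d, (g (x + h • EuclideanSpace.single i (1 : ℝ)) +
      g (x - h • EuclideanSpace.single i (1 : ℝ))) - g x) / h ^ 2 - walkGenerator g x| ≤
      h / 6 * maxThirdPartial g := by
  have hd' : (0 : ℝ) < d := by exact_mod_cast hd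
  have key (i : Fin d) := abs_symmetric_second_difference_sub_le
    (hg.hasDerivAt_comp_add_smul x (EuclideanSpace.single i (1 : ℝ)))
    ((hg.dirDeriv (EuclideanSpace.single i (1 : ℝ))).hasDerivAt_comp_add_smul x _)
    ((hg.iterate_dirDeriv (EuclideanSpace.single i (1 : ℝ)) 2).hasDerivAt_comp_add_smul x _)
    (M := maxThirdPartial g) (fun s => by
      refine le_trans ?_ (supNorm_thirdPartial_le_max g i)
      rw [thirdPartial_eq hg]
      exact abs_le_supNorm (hg.iterate_dirDeriv _ 3).continuous (hc.iterate_dirDeriv _ 3) _) hh.le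
  rw [walkGenerator_eq_sum hg]
  set a : Fin d → ℝ := fun i => g (x + h • EuclideanSpace.single i (1 : ℝ)) +
    g (x - h • EuclideanSpace.single i (1 : ℝ)) with ha
  set b : Fin d → ℝ := fun i => dirDeriv (EuclideanSpace.single i (1 : ℝ))
    (dirDeriv (EuclideanSpace.single i 1) g) x with hb
  have key' (i : Fin d) : |a i - 2 * g x - h ^ 2 * b i| ≤ maxThirdPartial g / 3 * h ^ 3 := by
    simpa [ha, hb, sub_eq_add_neg] using key i
  -- The discretization error is an average of one-dimensional second-difference errors, so the
  -- factor `d` cancels.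
  have hsum : (1 / (2 * (d : ℝ)) * ∑ i, a i - g x) / h ^ 2 - 1 / (2 * (d : ℝ)) * ∑ i, b i =
      1 / (2 * d * h ^ 2) * ∑ i, (a i - 2 * g x - h ^ 2 * b i) := by
    rw [Finset.sum_sub_distrib, Finset.sum_sub_distrib, ← Finset.mul_sum _ b]
    simp only [Finset.sum_const, Finset.card_univ, Fintype.card_fin, nsmul_eq_mul]
    field_simp
  rw [hsum, abs_mul, abs_of_nonneg (by positivity)]
  calc 1 / (2 * d * h ^ 2) * |∑ i, (a i - 2 * g x - h ^ 2 * b i)|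
      ≤ 1 / (2 * d * h ^ 2) * ∑ i : Fin d, maxThirdPartial g / 3 * h ^ 3 := by
        gcongr
        exact (Finset.abs_sum_le_sum_abs _ _).trans (Finset.sum_le_sum fun i _ => key' i)
    _ = h / 6 * maxThirdPartial g := by
        simp only [Finset.sum_const, Finset.card_univ, Fintype.card_fin, nsmul_eq_mul]
        field_simp
        ring

end Generator

/-! ### The heat semigroup: contraction and Fourier representation. -/

section HeatSemigroup

open MeasureTheory FourierTransform SchwartzMap

variable {d : ℕ}

theorem integral_heat_kernel {s : ℝ} (hs : 0 < s) :
    ∫ z : EuclideanSpace ℝ (Fin d),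
      (4 * Real.pi * s) ^ (-(d : ℝ) / 2) * Real.exp (-‖z‖ ^ 2 / (4 * s)) = 1 := by
  have h := GaussianFourier.integral_rexp_neg_mul_sq_norm (V := EuclideanSpace ℝ (Fin d))
    (b := (4 * s)⁻¹) (by positivity)
  have h2 (z : EuclideanSpace ℝ (Fin d)) :
      Real.exp (-‖z‖ ^ 2 / (4 * s)) = Real.exp (-(4 * s)⁻¹ * ‖z‖ ^ 2) := by
    congr 1; field_simp
  simp only [h2]
  rw [integral_const_mul, h, finrank_euclideanSpace_fin,
    show Real.pi / (4 * s)⁻¹ = 4 * Real.pi * s by field_simp,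
    ← Real.rpow_add (by positivity), neg_div, neg_add_cancel, Real.rpow_zero]

/-- The heat semigroup is the convolution with a probability measure. -/
theorem exists_heatSemigroup_eq_integral (d : ℕ) {s : ℝ} (hs : 0 ≤ s) :
    ∃ μ : Measure (EuclideanSpace ℝ (Fin d)), IsProbabilityMeasure μ ∧
      ∀ g x, heatSemigroup s g x = ∫ z, g (x - z) ∂μ := by
  rcases hs.eq_or_lt with rfl | hs
  · refine ⟨Measure.dirac 0, inferInstance, fun g x => ?_⟩
    simp [heatSemigroup]
  set k : EuclideanSpace ℝ (Fin d) → ℝ := fun z =>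
    (4 * Real.pi * s) ^ (-(d : ℝ) / 2) * Real.exp (-‖z‖ ^ 2 / (4 * s)) with hk
  have hk0 : ∀ z, 0 ≤ k z := fun z => by positivity
  have hkm : Measurable k := by fun_prop
  have hki : ∫ z, k z = 1 := integral_heat_kernel hs
  refine ⟨volume.withDensity fun z => ENNReal.ofReal (k z), ⟨?_⟩, fun g x => ?_⟩
  · rw [withDensity_apply _ MeasurableSet.univ, Measure.restrict_univ,
      ← ofReal_integral_eq_lintegral_ofReal _ (Filter.Eventually.of_forall hk0), hki,
      ENNReal.ofReal_one]
    exact Integrable.of_integral_ne_zero (by rw [hki]; exact one_ne_zero)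
  · rw [integral_withDensity_eq_integral_toReal_smul (by fun_prop)
      (Filter.Eventually.of_forall fun _ => ENNReal.ofReal_lt_top)]
    rw [heatSemigroup, if_neg hs.ne', ← integral_sub_left_eq_self _ volume x]
    simp only [sub_sub_cancel, ENNReal.toReal_ofReal (hk0 _), smul_eq_mul]
    rfl

theorem abs_heatSemigroup_le {s : ℝ} (hs : 0 ≤ s) {g : EuclideanSpace ℝ (Fin d) → ℝ} {c : ℝ}
    (hg : ∀ x, |g x| ≤ c) (x : EuclideanSpace ℝ (Fin d)) : |heatSemigroup s g x| ≤ c := by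
  obtain ⟨μ, hμ, h⟩ := exists_heatSemigroup_eq_integral d hs
  rw [h]
  simpa using norm_integral_le_of_norm_le_const (μ := μ) (f := fun z => g (x - z))
    (Filter.Eventually.of_forall fun z => hg (x - z))

/-- Convexity at `v` makes the remainder nonnegative; convexity at `u` bounds it by `(u - v) (e^{-v}
- e^{-u})`, and `e^{-·}` is 1-Lipschitz on the half-line. -/
theorem abs_exp_neg_sub_linear_le {u v : ℝ} (hu : 0 ≤ u) (hv : 0 ≤ v) :
    |Real.exp (-u) - Real.exp (-v) + (u - v) * Real.exp (-v)| ≤ (u - v) ^ 2 := by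
  have key {a b : ℝ} : Real.exp (-b) * (1 + (b - a)) ≤ Real.exp (-a) := by
    have h := Real.add_one_le_exp (b - a)
    have h2 : Real.exp (-a) = Real.exp (-b) * Real.exp (b - a) := by
      rw [← Real.exp_add]; congr 1; ring
    rw [h2]
    exact mul_le_mul_of_nonneg_left (by linarith) (Real.exp_pos _).le
  have h1 := key (a := u) (b := v)
  have h2 := key (a := v) (b := u)
  have hu1 : Real.exp (-u) ≤ 1 := Real.exp_le_one_iff.2 (by linarith)
  have hv1 : Real.exp (-v) ≤ 1 := Real.exp_le_one_iff.2 (by linarith)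
  rw [abs_of_nonneg (by linarith)]
  have h3 : (u - v) * (Real.exp (-v) - Real.exp (-u)) ≤ (u - v) ^ 2 := by
    rw [sq]
    rcases le_total u v with h | h
    · refine mul_le_mul_of_nonpos_left ?_ (by linarith)
      have := mul_le_mul_of_nonneg_right hu1 (sub_nonneg.2 h)
      linarith
    · refine mul_le_mul_of_nonneg_left ?_ (by linarith)
      have := mul_le_mul_of_nonneg_right hv1 (sub_nonneg.2 h)
      linarith
  linarith

/-- The Fourier representation of the heat semigroup on a Schwartz function. -/
theorem heatSemigroup_fourier {s : ℝ} (hs : 0 ≤ s) {g : EuclideanSpace ℝ (Fin d) → ℝ}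
    {φ : 𝓢(EuclideanSpace ℝ (Fin d), ℂ)} (hφ : ∀ x, φ x = g x) (x : EuclideanSpace ℝ (Fin d)) :
    (heatSemigroup s g x : ℂ) = ∫ ξ, Complex.exp (-(4 * Real.pi ^ 2 * s : ℝ) * ‖ξ‖ ^ 2 +
      2 * Real.pi * Complex.I * inner ℝ x ξ) * 𝓕 φ ξ := by
  rcases hs.eq_or_lt with rfl | hs
  · have h : 𝓕⁻ (𝓕 φ) x = φ x := by rw [FourierTransform.fourierInv_fourier_eq]
    rw [heatSemigroup, if_pos rfl, ← hφ, ← h, fourierInv_coe, Real.fourierInv_eq']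
    refine integral_congr_ae (Filter.Eventually.of_forall fun ξ => ?_)
    simp only [smul_eq_mul, real_inner_comm]
    congr 2
    push_cast
    ring
  have hb : 0 < ((4 * Real.pi ^ 2 * s : ℝ) : ℂ).re := by
    rw [Complex.ofReal_re]; positivity
  have hG := GaussianFourier.integrable_cexp_neg_mul_sq_norm_add hb (2 * Real.pi * Complex.I) x
  -- Move the Fourier transform from the modulated Gaussian onto `φ`; the transform of that Gaussian
  -- is the heat kernel centred at `x`.
  have h := VectorFourier.integral_fourierIntegral_smul_eq_flip
    (L := innerₗ (EuclideanSpace ℝ (Fin d))) Real.continuous_fourierChar continuous_inner hG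
    (φ.integrable (μ := volume))
  have h2 : ∫ ξ, 𝓕 (fun v : EuclideanSpace ℝ (Fin d) =>
      Complex.exp (-(4 * Real.pi ^ 2 * s : ℝ) * ‖v‖ ^ 2 +
      2 * Real.pi * Complex.I * inner ℝ x v)) ξ * φ ξ =
    ∫ ξ, Complex.exp (-(4 * Real.pi ^ 2 * s : ℝ) * ‖ξ‖ ^ 2 +
      2 * Real.pi * Complex.I * inner ℝ x ξ) * 𝓕 φ ξ := by
    simpa using! h
  rw [← h2, heatSemigroup, if_neg hs.ne', ← integral_complex_ofReal]
  refine integral_congr_ae (Filter.Eventually.of_forall fun y => ?_)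
  simp only
  rw [fourier_gaussian_innerProductSpace' hb, hφ, finrank_euclideanSpace_fin]
  have h3 : ((Real.pi : ℂ) / ((4 * Real.pi ^ 2 * s : ℝ) : ℂ)) ^ ((d : ℂ) / 2) =
      (((4 * Real.pi * s) ^ (-(d : ℝ) / 2) : ℝ) : ℂ) := by
    have : (Real.pi : ℂ) / ((4 * Real.pi ^ 2 * s : ℝ) : ℂ) = (((4 * Real.pi * s)⁻¹ : ℝ) : ℂ) := by
      rw [← Complex.ofReal_div]
      congr 1
      field_simp
    rw [this, neg_div, Real.rpow_neg (by positivity), ← Real.inv_rpow (by positivity),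
      Complex.ofReal_cpow (by positivity)]
    push_cast; rfl
  rw [h3]
  push_cast
  congr 3
  have : (Real.pi : ℂ) ≠ 0 := by exact_mod_cast Real.pi_ne_zero
  have : (s : ℂ) ≠ 0 := by exact_mod_cast hs.ne'
  field_simp

theorem norm_heat_symbol_le {s : ℝ} (hs : 0 ≤ s) (x ξ : EuclideanSpace ℝ (Fin d)) :
    ‖Complex.exp (-(4 * Real.pi ^ 2 * s : ℝ) * ‖ξ‖ ^ 2 +
      2 * Real.pi * Complex.I * inner ℝ x ξ)‖ ≤ 1 := by
  rw [Complex.norm_exp]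
  refine Real.exp_le_one_iff.2 ?_
  have h : (-(4 * Real.pi ^ 2 * s : ℝ) * ‖ξ‖ ^ 2 + 2 * Real.pi * Complex.I * inner ℝ x ξ : ℂ) =
      ((-(4 * Real.pi ^ 2 * s * ‖ξ‖ ^ 2) : ℝ) : ℂ) +
        ((2 * Real.pi * inner ℝ x ξ : ℝ) : ℂ) * Complex.I := by
    push_cast; ring
  rw [h]
  simp only [Complex.add_re, Complex.ofReal_re, Complex.re_ofReal_mul, Complex.I_re, mul_zero,
    add_zero]
  exact neg_nonpos.2 (by positivity)

theorem integrable_heat_symbol_mul_fourier {s : ℝ} (hs : 0 ≤ s)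
    (φ : 𝓢(EuclideanSpace ℝ (Fin d), ℂ)) (x : EuclideanSpace ℝ (Fin d)) :
    Integrable fun ξ => Complex.exp (-(4 * Real.pi ^ 2 * s : ℝ) * ‖ξ‖ ^ 2 +
      2 * Real.pi * Complex.I * inner ℝ x ξ) * 𝓕 φ ξ :=
  (𝓕 φ).integrable.bdd_mul (c := 1) (Continuous.aestronglyMeasurable (by fun_prop))
    (Filter.Eventually.of_forall fun ξ => norm_heat_symbol_le hs x ξ)

theorem SchwartzMap.fourier_laplacian_apply (φ : 𝓢(EuclideanSpace ℝ (Fin d), ℂ))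
    (ξ : EuclideanSpace ℝ (Fin d)) :
    𝓕 (Laplacian.laplacian φ) ξ = -(4 * Real.pi ^ 2 * ‖ξ‖ ^ 2 : ℝ) * 𝓕 φ ξ := by
  rw [laplacian_eq_fourierMultiplierCLM, FourierTransform.fourier_smul, fourierMultiplierCLM_apply,
    FourierTransform.fourier_fourierInv_eq, smul_apply,
    smulLeftCLM_apply_apply (by fun_prop)]
  simp
  ring

theorem exists_schwartzMap_eq {g : EuclideanSpace ℝ (Fin d) → ℝ} (hg : ContDiff ℝ ∞ g)
    (hc : HasCompactSupport g) : ∃ φ : 𝓢(EuclideanSpace ℝ (Fin d), ℂ), (∀ x, φ x = g x) ∧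
      ∀ x, Laplacian.laplacian φ x = (Laplacian.laplacian g x : ℝ) := by
  have hg' : ContDiff ℝ ∞ fun x => (g x : ℂ) := Complex.ofRealCLM.contDiff.comp hg
  have hc' : HasCompactSupport fun x => (g x : ℂ) := hc.comp_left Complex.ofReal_zero
  refine ⟨hc'.toSchwartzMap hg', fun x => rfl, fun x => ?_⟩
  rw [SchwartzMap.laplacian_apply]
  exact (hg.contDiffAt.of_le (by simpa using ENat.LEInfty.out)).laplacian_CLM_comp_left
    (l := Complex.ofRealCLM)

/-- The heat semigroup solves the heat equation, uniformly in space. -/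
theorem exists_abs_heatSemigroup_sub_le {g : EuclideanSpace ℝ (Fin d) → ℝ} (hg : ContDiff ℝ ∞ g)
    (hc : HasCompactSupport g) : ∃ K : ℝ, ∀ s r, 0 ≤ s → 0 ≤ r → ∀ x,
      |heatSemigroup s g x - heatSemigroup r g x -
        (s - r) * heatSemigroup r (Laplacian.laplacian g) x| ≤ K * (s - r) ^ 2 := by
  obtain ⟨φ, hφ, hφ2⟩ := exists_schwartzMap_eq hg hc
  -- The symbol's quadratic remainder is at most `(4π² |ξ|² (s - r))²`, so `K` is a fourth moment of
  -- `𝓕 φ`, finite because `𝓕 φ` is Schwartz.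
  refine ⟨∫ ξ, (4 * Real.pi ^ 2) ^ 2 * (‖ξ‖ ^ 4 * ‖𝓕 φ ξ‖), fun s r hs hr x => ?_⟩
  rw [← Real.norm_eq_abs, ← Complex.norm_real]
  push_cast
  rw [heatSemigroup_fourier hs hφ, heatSemigroup_fourier hr hφ, heatSemigroup_fourier hr hφ2,
    ← integral_sub (integrable_heat_symbol_mul_fourier hs φ x)
      (integrable_heat_symbol_mul_fourier hr φ x), ← integral_const_mul, ← integral_sub
      ((integrable_heat_symbol_mul_fourier hs φ x).sub' (integrable_heat_symbol_mul_fourier hr φ x))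
      ((integrable_heat_symbol_mul_fourier hr _ x).const_mul _), ← integral_mul_const]
  refine norm_integral_le_of_norm_le
    ((((𝓕 φ).integrable_pow_mul volume 4).const_mul _).mul_const _)
    (Filter.Eventually.of_forall fun ξ => ?_)
  rw [SchwartzMap.fourier_laplacian_apply]
  have h1 (s : ℝ) : Complex.exp (-(4 * Real.pi ^ 2 * s : ℝ) * ‖ξ‖ ^ 2 +
      2 * Real.pi * Complex.I * inner ℝ x ξ) = (Real.exp (-(4 * Real.pi ^ 2 * s * ‖ξ‖ ^ 2)) : ℂ) *
        Complex.exp ((2 * Real.pi * inner ℝ x ξ : ℝ) * Complex.I) := by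
    rw [Complex.ofReal_exp, ← Complex.exp_add]
    congr 1; push_cast; ring
  rw [h1 s, h1 r]
  set u := 4 * Real.pi ^ 2 * s * ‖ξ‖ ^ 2 with hu
  set v := 4 * Real.pi ^ 2 * r * ‖ξ‖ ^ 2 with hv
  set e := Complex.exp ((2 * Real.pi * inner ℝ x ξ : ℝ) * Complex.I) with he
  have h2 : (Real.exp (-u) : ℂ) * e * 𝓕 φ ξ - Real.exp (-v) * e * 𝓕 φ ξ -
      ((s : ℂ) - r) * (Real.exp (-v) * e * (-(4 * Real.pi ^ 2 * ‖ξ‖ ^ 2 : ℝ) * 𝓕 φ ξ)) =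
      ((Real.exp (-u) - Real.exp (-v) + (u - v) * Real.exp (-v) : ℝ) : ℂ) * e * 𝓕 φ ξ := by
    rw [hu, hv]; push_cast; ring
  rw [h2, norm_mul, norm_mul, Complex.norm_real, Complex.norm_exp_ofReal_mul_I, mul_one]
  refine (mul_le_mul_of_nonneg_right (abs_exp_neg_sub_linear_le (u := u) (v := v)
    (by positivity) (by positivity)) (norm_nonneg _)).trans (le_of_eq ?_)
  rw [hu, hv]; ring

end HeatSemigroup

/-! ### The walk operator on bounded lattice functions. -/

section WalkOperator

open BoundedContinuousFunction

variable {d : ℕ}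

theorem abs_transitionOp_le (hd : 1 ≤ d) {g : (Fin d → ℤ) → ℝ} {c : ℝ} (hg : ∀ x, |g x| ≤ c)
    (x : Fin d → ℤ) : |transitionOp g x| ≤ c := by
  have hd' : (0 : ℝ) < d := by exact_mod_cast hd
  rw [transitionOp, abs_mul, abs_of_nonneg (by positivity)]
  calc 1 / (2 * (d : ℝ)) * |∑ i : Fin d, (g (x + Pi.single i 1) + g (x - Pi.single i 1))|
      ≤ 1 / (2 * (d : ℝ)) * ∑ i : Fin d, (c + c) := by
        gcongr
        exact (Finset.abs_sum_le_sum_abs _ _).trans (Finset.sum_le_sum fun i _ =>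
          (abs_add_le _ _).trans (add_le_add (hg _) (hg _)))
    _ = c := by
        simp only [Finset.sum_const, Finset.card_univ, Fintype.card_fin, nsmul_eq_mul]
        field_simp
        ring

/-- The transition operator of the simple random walk on bounded functions. -/
noncomputable def transitionCLM (hd : 1 ≤ d) :
    ((Fin d → ℤ) →ᵇ ℝ) →L[ℝ] ((Fin d → ℤ) →ᵇ ℝ) :=
  LinearMap.mkContinuous
    { toFun := fun g => ofNormedAddCommGroupDiscrete (transitionOp g) ‖g‖
        (abs_transitionOp_le hd g.norm_coe_le_norm)
      map_add' := fun g h => by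
        ext x
        simp only [transitionOp, coe_ofNormedAddCommGroupDiscrete,
          BoundedContinuousFunction.coe_add,
          Pi.add_apply, ← mul_add, ← Finset.sum_add_distrib]
        congr 1
        exact Finset.sum_congr rfl fun i _ => by ring
      map_smul' := fun c g => by
        ext x
        simp only [transitionOp, coe_ofNormedAddCommGroupDiscrete,
          BoundedContinuousFunction.coe_smul,
          smul_eq_mul, ← mul_add, ← Finset.mul_sum, RingHom.id_apply]
        ring }
    1 fun g => by
      rw [one_mul, norm_le (norm_nonneg _)]
      exact abs_transitionOp_le hd g.norm_coe_le_norm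

theorem transitionCLM_apply (hd : 1 ≤ d) (g : (Fin d → ℤ) →ᵇ ℝ) :
    ⇑(transitionCLM hd g) = transitionOp g := rfl

theorem norm_transitionCLM_le (hd : 1 ≤ d) : ‖transitionCLM hd‖ ≤ 1 :=
  LinearMap.mkContinuous_norm_le _ zero_le_one _

theorem transitionCLM_pow_apply (hd : 1 ≤ d) (m : ℕ) (g : (Fin d → ℤ) →ᵇ ℝ) :
    ⇑((transitionCLM hd ^ m) g) = transitionOp^[m] g := by
  induction m with
  | zero => rfl
  | succ m ih =>
    rw [pow_succ', mul_apply_eq_comp, transitionCLM_apply, ih, Function.iterate_succ_apply']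

theorem scaleOp_add_single (n : ℕ) (u : EuclideanSpace ℝ (Fin d) → ℝ) (x : Fin d → ℤ) (i : Fin d) :
    scaleOp n u (x + Pi.single i 1) =
      u (WithLp.toLp 2 (fun j => (x j : ℝ) / √n) + (1 / √n) • EuclideanSpace.single i (1 : ℝ)) := by
  rw [scaleOp]
  congr 1
  ext j
  by_cases h : j = i
  · subst h; simp; ring
  · simp [h]

theorem scaleOp_sub_single (n : ℕ) (u : EuclideanSpace ℝ (Fin d) → ℝ) (x : Fin d → ℤ) (i : Fin d) :
    scaleOp n u (x - Pi.single i 1) =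
      u (WithLp.toLp 2 (fun j => (x j : ℝ) / √n) - (1 / √n) • EuclideanSpace.single i (1 : ℝ)) := by
  rw [scaleOp]
  congr 1
  ext j
  by_cases h : j = i
  · subst h; simp; ring
  · simp [h]

end WalkOperator

/-! ### Heat flow against the rescaled walk generator. -/

section Semigroup

open MeasureTheory

variable {d : ℕ}

/-- The heat semigroup commutes with the generator of the rescaled random walk. -/
theorem heatSemigroup_discrete_generator {s : ℝ} (hs : 0 ≤ s)
    {f : EuclideanSpace ℝ (Fin d) → ℝ} (hf : ContDiff ℝ ∞ f) (hc : HasCompactSupport f) (h : ℝ)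
    (x : EuclideanSpace ℝ (Fin d)) :
    heatSemigroup s (fun y => (1 / (2 * (d : ℝ)) * ∑ i : Fin d,
      (f (y + h • EuclideanSpace.single i (1 : ℝ)) + f (y - h • EuclideanSpace.single i (1 : ℝ))) -
        f y) / h ^ 2 - walkGenerator f y) x =
      (1 / (2 * (d : ℝ)) * ∑ i : Fin d,
        (heatSemigroup s f (x + h • EuclideanSpace.single i (1 : ℝ)) +
          heatSemigroup s f (x - h • EuclideanSpace.single i (1 : ℝ))) -
        heatSemigroup s f x) / h ^ 2 - heatSemigroup s (walkGenerator f) x := by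
  obtain ⟨μ, hμ, H⟩ := exists_heatSemigroup_eq_integral d hs
  have hi {g : EuclideanSpace ℝ (Fin d) → ℝ} (hg : Continuous g) (hgc : HasCompactSupport g)
      (y : EuclideanSpace ℝ (Fin d)) : Integrable (fun z => g (y - z)) μ := by
    obtain ⟨C, hC⟩ := hg.bounded_above_of_compact_support hgc
    exact Integrable.of_bound (Continuous.aestronglyMeasurable (by fun_prop)) C
      (Filter.Eventually.of_forall fun z => hC _)
  have hif := hi hf.continuous hc
  have hsum (i : Fin d) : Integrable (fun z =>
      f (x + h • EuclideanSpace.single i (1 : ℝ) - z) +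
        f (x - h • EuclideanSpace.single i (1 : ℝ) - z)) μ := (hif _).add (hif _)
  simp only [H]
  simp only [sub_add_eq_add_sub, sub_right_comm x _ (h • _)]
  rw [integral_sub ((((integrable_finsetSum _ fun i _ => hsum i).const_mul _).sub'
      (hif x)).div_const _) (hi hf.walkGenerator.continuous (hc.walkGenerator hf) x),
    integral_div, integral_sub ((integrable_finsetSum _ fun i _ => hsum i).const_mul _) (hif x),
    integral_const_mul, integral_finsetSum _ fun i _ => hsum i]
  simp only [integral_add (hif _) (hif _)]

theorem walkSemigroup_zero (f : EuclideanSpace ℝ (Fin d) → ℝ) : walkSemigroup 0 f = f := by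
  ext x; simp [walkSemigroup, heatSemigroup]

theorem abs_walkSemigroup_le {s : ℝ} (hs : 0 ≤ s) {g : EuclideanSpace ℝ (Fin d) → ℝ} {c : ℝ}
    (hg : ∀ x, |g x| ≤ c) (x : EuclideanSpace ℝ (Fin d)) : |walkSemigroup s g x| ≤ c :=
  abs_heatSemigroup_le (by positivity) hg x

theorem exists_abs_walkSemigroup_sub_le {f : EuclideanSpace ℝ (Fin d) → ℝ} (hf : ContDiff ℝ ∞ f)
    (hc : HasCompactSupport f) : ∃ K : ℝ, ∀ s r, 0 ≤ s → 0 ≤ r → ∀ x,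
      |walkSemigroup s f x - walkSemigroup r f x -
        (s - r) * walkSemigroup r (walkGenerator f) x| ≤ K * (s - r) ^ 2 := by
  obtain ⟨K, hK⟩ := exists_abs_heatSemigroup_sub_le hf hc
  refine ⟨K / (2 * d) ^ 2, fun s r hs hr x => ?_⟩
  have h := hK (s / (2 * d)) (r / (2 * d)) (by positivity) (by positivity) x
  obtain ⟨μ, hμ, H⟩ := exists_heatSemigroup_eq_integral d (s := r / (2 * d)) (by positivity)
  have h2 : walkSemigroup r (walkGenerator f) x =
      1 / (2 * (d : ℝ)) * heatSemigroup (r / (2 * d)) (Laplacian.laplacian f) x := by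
    rw [walkSemigroup, H, H, ← integral_const_mul]
    rfl
  rw [h2, walkSemigroup, walkSemigroup]
  convert h using 1
  · congr 2; ring
  · ring

/-- Uniform in `s`: the discretization error is estimated on `f` itself and then pushed through the
heat semigroup, so derivatives of the evolved function are never needed. -/
theorem abs_discrete_generator_walkSemigroup_sub_le (hd : 1 ≤ d)
    {f : EuclideanSpace ℝ (Fin d) → ℝ} (hf : ContDiff ℝ ∞ f) (hc : HasCompactSupport f)
    {n : ℕ} (hn : 1 ≤ n) {s : ℝ} (hs : 0 ≤ s) (x : Fin d → ℤ) :
    |scaleOp n (walkSemigroup s (walkGenerator f)) x -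
      n * (transitionOp (scaleOp n (walkSemigroup s f)) x - scaleOp n (walkSemigroup s f) x)| ≤
      1 / (6 * √n) * maxThirdPartial f := by
  have hn' : (0 : ℝ) < n := by exact_mod_cast hn
  have hsq : (1 / √(n : ℝ)) ^ 2 = (n : ℝ)⁻¹ := by
    rw [one_div, inv_pow, Real.sq_sqrt hn'.le]
  have h := abs_heatSemigroup_le (s := s / (2 * d)) (by positivity)
    (abs_discrete_generator_sub_le hd hf hc (h := 1 / √n) (by positivity))
    (WithLp.toLp 2 fun j => (x j : ℝ) / √n)
  rw [heatSemigroup_discrete_generator (by positivity) hf hc] at h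
  rw [abs_sub_comm, transitionOp]
  simp only [scaleOp_add_single, scaleOp_sub_single]
  convert h using 1
  · congr 2
    rw [hsq, div_inv_eq_mul, mul_comm]
    rfl
  · field_simp

end Semigroup

/-! ### Assembly of the estimates. -/

section MainEstimate

open BoundedContinuousFunction

variable {d : ℕ}

theorem abs_iterate_transitionOp_sub_walkSemigroup_le (hd : 1 ≤ d)
    {f : EuclideanSpace ℝ (Fin d) → ℝ} (hf : ContDiff ℝ ∞ f) (hc : HasCompactSupport f)
    {n : ℕ} (hn : 1 ≤ n) {t : ℝ} (ht : 0 ≤ t) (x : Fin d → ℤ) :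
    |transitionOp^[⌊(n : ℝ) * t⌋₊] (scaleOp n f) x - scaleOp n (walkSemigroup t f) x| ≤
      (√(t / n) + 1 / n) * (supNorm (walkGenerator f) + 1 / (6 * √n) * maxThirdPartial f) +
        t / (6 * √n) * maxThirdPartial f := by
  have hn' : (0 : ℝ) < n := by exact_mod_cast hn
  have hAc := hf.walkGenerator.continuous
  have hAs := hc.walkGenerator hf
  have hex {g : EuclideanSpace ℝ (Fin d) → ℝ} (hg : Continuous g) (hgc : HasCompactSupport g)
      (s : ℝ) : ∃ b : (Fin d → ℤ) →ᵇ ℝ, 0 ≤ s → ⇑b = scaleOp n (walkSemigroup s g) := by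
    by_cases hs : 0 ≤ s
    · exact ⟨ofNormedAddCommGroupDiscrete (scaleOp n (walkSemigroup s g)) (supNorm g)
        fun x => abs_walkSemigroup_le hs (abs_le_supNorm hg hgc) _, fun _ => rfl⟩
    -- Negative times get a dummy value; only one-sided derivatives on `[0, ∞)` are used.
    · exact ⟨0, fun h => absurd h hs⟩
  choose w hw using hex hf.continuous hc
  choose w' hw' using hex hAc hAs
  obtain ⟨K, hK⟩ := exists_abs_walkSemigroup_sub_le hf hc
  set L := transitionCLM hd
  have hL := norm_transitionCLM_le hd
  have hderiv (s : ℝ) (hs : 0 ≤ s) : HasDerivWithinAt w (w' s) (Set.Ici 0) s := by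
    rw [hasDerivWithinAt_iff_isLittleO]
    have hO : (fun r => w r - w s - (r - s) • w' s) =O[nhdsWithin s (Set.Ici 0)]
        fun r => (r - s) ^ 2 := by
      refine Asymptotics.IsBigO.of_bound |K| ?_
      filter_upwards [self_mem_nhdsWithin] with r hr
      refine (norm_le (by positivity)).2 fun y => ?_
      have h := hK r s hr hs (WithLp.toLp 2 fun j => (y j : ℝ) / √n)
      rw [Real.norm_of_nonneg (sq_nonneg _)]
      refine le_trans ?_ (h.trans (mul_le_mul_of_nonneg_right (le_abs_self K) (sq_nonneg _)))
      simp [hw r hr, hw s hs, hw' s hs, scaleOp]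
    refine hO.trans_isLittleO (Asymptotics.IsLittleO.mono ?_ nhdsWithin_le_nhds)
    exact (Asymptotics.isLittleO_pow_sub_sub s one_lt_two).congr_left fun r => by simp
  have hgen (s : ℝ) (hs : 0 ≤ s) :
      ‖w' s - (n : ℝ) • (L (w s) - w s)‖ ≤ 1 / (6 * √n) * maxThirdPartial f := by
    refine (norm_le (mul_nonneg (by positivity) (maxThirdPartial_nonneg f))).2 fun y => ?_
    have h := abs_discrete_generator_walkSemigroup_sub_le hd hf hc hn hs y
    simpa [L, transitionCLM_apply, hw s hs, hw' s hs] using h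
  set δ := supNorm (walkGenerator f) + 1 / (6 * √n) * maxThirdPartial f with hδ
  -- At time zero `n (L - 1) w` is within the defect of `P_n 𝔄 f`, so one step of the walk has size
  -- `O(1/n)`.
  have hstep : ‖L (w 0) - w 0‖ ≤ 1 / n * δ := by
    have h1 : ‖w' 0‖ ≤ supNorm (walkGenerator f) := by
      refine (norm_le (supNorm_nonneg _)).2 fun y => ?_
      rw [hw' 0 le_rfl, walkSemigroup_zero]
      exact abs_le_supNorm hAc hAs _
    have h2 := norm_sub_norm_le ((n : ℝ) • (L (w 0) - w 0)) (w' 0)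
    rw [norm_sub_rev, norm_smul, Real.norm_of_nonneg hn'.le] at h2
    have h3 := hgen 0 le_rfl
    rw [one_div, ← div_eq_inv_mul, le_div_iff₀' hn', hδ]
    linarith
  set m := ⌊(n : ℝ) * t⌋₊ with hm
  have hm1 : (m : ℝ) ≤ n * t := Nat.floor_le (by positivity)
  have hm2 : (n : ℝ) * t - m ≤ 1 := by linarith [Nat.lt_floor_add_one ((n : ℝ) * t)]
  have happ := norm_pow_apply_sub_le hL hn'.le ht hderiv hgen (by rwa [mul_comm t])
  have hpt := ((L ^ m) (w 0) - w t).norm_coe_le_norm x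
  rw [BoundedContinuousFunction.coe_sub, Pi.sub_apply, transitionCLM_pow_apply, hw 0 le_rfl,
    hw t ht,
    walkSemigroup_zero, Real.norm_eq_abs] at hpt
  have hδ0 : 0 ≤ 1 / n * δ := (norm_nonneg _).trans hstep
  have hb1 : √m * ‖L (w 0) - w 0‖ ≤ √(t / n) * δ := by
    have hsq : √(n * t) * (1 / n) = √(t / n) := by
      rw [Real.sqrt_mul hn'.le, Real.sqrt_div ht]
      nth_rewrite 2 [← Real.mul_self_sqrt hn'.le]
      field_simp
    calc √m * ‖L (w 0) - w 0‖ ≤ √(n * t) * (1 / n * δ) := by gcongr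
      _ = √(t / n) * δ := by rw [← mul_assoc, hsq]
  have hb2 : (t * n - m) * ‖L (w 0) - w 0‖ ≤ 1 / n * δ := by
    calc (t * n - m) * ‖L (w 0) - w 0‖ ≤ 1 * (1 / n * δ) := by
          gcongr
          linarith
      _ = 1 / n * δ := one_mul _
  have hb3 : 1 / (6 * √n) * maxThirdPartial f * t = t / (6 * √n) * maxThirdPartial f := by ring
  rw [hb3, add_mul] at happ
  rw [add_mul]
  linarith

/-- The target is weaker: factors `1` become `d`, a nonnegative term is added, and `λ` times the
third-derivative bound is traded for the resolvent one. -/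
theorem semigroup_estimate_le_errorBound (hd : 1 ≤ d)
    {f : EuclideanSpace ℝ (Fin d) → ℝ} (hf : ContDiff ℝ ∞ f) (hc : HasCompactSupport f)
    (n : ℕ) {t l : ℝ} (ht : 0 ≤ t) (hl : 0 < l) :
    (√(t / n) + 1 / n) * (supNorm (walkGenerator f) + 1 / (6 * √n) * maxThirdPartial f) +
        t / (6 * √n) * maxThirdPartial f ≤ errorBound l t f n := by
  have hd' : (1 : ℝ) ≤ d := by exact_mod_cast hd
  have hM := maxThirdPartial_nonneg f
  have hres := mul_maxThirdPartial_le_resolvent hf hc hl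
  have h1 : t / (6 * √n) * maxThirdPartial f ≤ d * t / (6 * l * √n) *
      maxThirdPartial fun x => l * f x - walkGenerator f x := by
    calc t / (6 * √n) * maxThirdPartial f = 1 * t / (6 * l * √n) * (l * maxThirdPartial f) := by
          field_simp
      _ ≤ _ := by gcongr
  have h2 : 0 ≤ d / (3 * l * √n) * maxThirdPartial f := by positivity
  have h3 : (√(t / n) + 1 / n) * (supNorm (walkGenerator f) + 1 / (6 * √n) * maxThirdPartial f) ≤
      (√(t / n) + 1 / n) * (supNorm (walkGenerator f) + d / (6 * √n) * maxThirdPartial f) := by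
    gcongr
  rw [errorBound]
  linarith

theorem errorBound_le {f : EuclideanSpace ℝ (Fin d) → ℝ} {n : ℕ} (hn : 1 ≤ n) {t l : ℝ}
    (ht : 0 ≤ t) (hl : 0 < l) :
    errorBound l t f n ≤ ((√t + 1) * (supNorm (walkGenerator f) + d / 6 * maxThirdPartial f) +
      d / (3 * l) * maxThirdPartial f +
      d * t / (6 * l) * (maxThirdPartial fun x => l * f x - walkGenerator f x)) / √n := by
  have hn' : (1 : ℝ) ≤ n := by exact_mod_cast hn
  have hq : 1 ≤ √(n : ℝ) := Real.one_le_sqrt.2 hn'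
  have hM := maxThirdPartial_nonneg f
  have hA := supNorm_nonneg (walkGenerator f)
  have h1 : √(t / n) + 1 / n ≤ (√t + 1) / √n := by
    rw [Real.sqrt_div ht, add_div]
    gcongr
    rw [Real.sqrt_le_left (by positivity)]
    exact le_self_pow₀ hn' two_ne_zero
  have h2 : d / (6 * √(n : ℝ)) ≤ (d : ℝ) / 6 := by
    gcongr
    linarith
  have h3 : (√(t / n) + 1 / n) * (supNorm (walkGenerator f) + d / (6 * √n) * maxThirdPartial f) ≤
      (√t + 1) / √n * (supNorm (walkGenerator f) + d / 6 * maxThirdPartial f) := by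
    gcongr
  rw [errorBound]
  refine (add_le_add_left (add_le_add_left h3 _) _).trans (le_of_eq ?_)
  field_simp

end MainEstimate

theorem mainTheorem2 (d : ℕ) (hd : 1 ≤ d) (f : EuclideanSpace ℝ (Fin d) → ℝ)
    (hf : ContDiff ℝ ∞ f) (hfc : HasCompactSupport f)
    (t : ℝ) (ht : 0 ≤ t) (l : ℝ) (hl : 0 < l) :
    ∃ C : ℝ, 0 < C ∧ ∀ n : ℕ, 1 ≤ n →
      BddAbove (Set.range fun x : Fin d → ℤ =>
        |transitionOp^[⌊(n : ℝ) * t⌋₊] (scaleOp n f) x - scaleOp n (walkSemigroup t f) x|) ∧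
      supNorm (fun x : Fin d → ℤ =>
        transitionOp^[⌊(n : ℝ) * t⌋₊] (scaleOp n f) x - scaleOp n (walkSemigroup t f) x)
          ≤ errorBound l t f n ∧
      errorBound l t f n ≤ C / √(n : ℝ) := by
  have hM := maxThirdPartial_nonneg f
  have hM' := maxThirdPartial_nonneg fun x => l * f x - walkGenerator f x
  have hA := supNorm_nonneg (walkGenerator f)
  refine ⟨(√t + 1) * (supNorm (walkGenerator f) + d / 6 * maxThirdPartial f) +
      d / (3 * l) * maxThirdPartial f +
      -- The added `1` keeps the constant positive even when all the norms vanish.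
      d * t / (6 * l) * (maxThirdPartial fun x => l * f x - walkGenerator f x) + 1,
    by positivity, fun n hn => ?_⟩
  have hpt (x : Fin d → ℤ) :
      |transitionOp^[⌊(n : ℝ) * t⌋₊] (scaleOp n f) x - scaleOp n (walkSemigroup t f) x| ≤
        errorBound l t f n :=
    (abs_iterate_transitionOp_sub_walkSemigroup_le hd hf hfc hn ht x).trans
      (semigroup_estimate_le_errorBound hd hf hfc n ht hl)
  refine ⟨⟨_, Set.forall_mem_range.2 hpt⟩, ciSup_le hpt, (errorBound_le hn ht hl).trans ?_⟩
  exact div_le_div_of_nonneg_right (by linarith) (Real.sqrt_nonneg _)
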